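/- For integers $n\ge 0$ and $a$ let $\begin{bmatrix} n\\ a\end{bmatrix}_q=\dfrac{(q;q)_n}{(q;q)_a(q;q)_{n-a}}$ if $0\le a\le n$ and $0$ otherwise, where $(q;q)_n=\prod_{i=1}^{n}(1-q^i)$. For an integer $L\ge 0$, a positive integer $K$ and real numbers $\alpha,\beta$ put $$G(L;\alpha,\beta,K)=\sum_{j=-\infty}^{\infty}(-1)^j q^{Kj((\alpha+\beta)j+\alpha-\beta)/2}\begin{bmatrix} 2L\\ L-Kj\end{bmatrix}_q ,$$ a finite sum of real powers of $q$ with integer coefficients, and write $G(L;\alpha,\beta,K)\ge 0$ if it is a polynomial in $q$ all of whose coefficients are nonnegative. **Lemma 9.2.** Let $K$ be a positive integer and let $\alpha,\beta$ be real numbers. If $G(L;\alpha,\beta,K)\ge 0$ for all integers $L\ge 0$, then $G(L;\alpha',\beta',K')\ge 0$ for all integers $L\ge 0$, for each of the following choices of $(\alpha',\beta',K')$: 1. $(\alpha+K,\ \beta+K,\ 2K)$; 2. $(\alpha,\ \beta,\ 2K)$; 3. $(\alpha+K/2,\ \beta+K/2,\ 2K)$; 4. $(2\alpha,\ 2\beta,\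 2K)$; 5. $(\alpha+K,\ \beta+K,\ 3K)$. -/

import Mathlib

/-- The `q`-shifted factorial `(a;q)_n = ∏_{j=0}^{n-1} (1 - a q^j)`. -/
def qShifted {R : Type*} [CommRing R] (a q : R) (n : ℕ) : R :=
  ∏ j ∈ Finset.range n, (1 - a * q ^ j)

/-- The Gaussian binomial coefficient `[n, k]_q` for natural numbers `n`, `k`, as a polynomial
expression in `q`, given by the `q`-Pascal recursion. The closed form
`(q;q)_n / ((q;q)_k (q;q)_{n-k})` for `k ≤ n` is `gaussBinom_closed`, and the vanishing for
`n < k` is `gaussBinom_eq_zero`. -/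
def gaussBinom {R : Type*} [CommRing R] (q : R) : ℕ → ℕ → R
  | _, 0 => 1
  | 0, _ + 1 => 0
  | n + 1, k + 1 => gaussBinom q n k + q ^ (k + 1) * gaussBinom q n (k + 1)

theorem gaussBinom_eq_zero {R : Type*} [CommRing R] (q : R) (n : ℕ) :
    ∀ k : ℕ, n < k → gaussBinom q n k = 0 := by
  induction n with
  | zero =>
    intro k hk
    obtain ⟨m, rfl⟩ : ∃ m, k = m + 1 := ⟨k - 1, by omega⟩
    simp [gaussBinom]
  | succ n ih =>
    intro k hk
    obtain ⟨m, rfl⟩ : ∃ m, k = m + 1 := ⟨k - 1, by omega⟩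
    simp [gaussBinom, ih m (by omega), ih (m + 1) (by omega)]

theorem qShifted_succ {R : Type*} [CommRing R] (q : R) (n : ℕ) :
    qShifted q q (n + 1) = qShifted q q n * (1 - q ^ (n + 1)) := by
  rw [qShifted, Finset.prod_range_succ, pow_succ']
  rfl

/-- `[k + m, k]_q · (q;q)_k · (q;q)_m = (q;q)_{k+m}`. -/
theorem gaussBinom_closed {R : Type*} [CommRing R] (q : R) (k m : ℕ) :
    gaussBinom q (k + m) k * (qShifted q q k * qShifted q q m) = qShifted q q (k + m) := by
  have main : ∀ n k m : ℕ, k + m = n →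
      gaussBinom q n k * (qShifted q q k * qShifted q q m) = qShifted q q n := by
    intro n
    induction n with
    | zero =>
      intro k m h
      obtain ⟨rfl, rfl⟩ : k = 0 ∧ m = 0 := by omega
      simp [gaussBinom, qShifted]
    | succ n ih =>
      intro k m h
      rcases k with _ | k
      · obtain rfl : m = n + 1 := by omega
        simp [gaussBinom, qShifted]
      · have h1 := ih k m (by omega)
        rcases m with _ | m
        · obtain rfl : k = n := by omega
          have h0 := gaussBinom_eq_zero q k (k + 1) (by omega)
          rw [gaussBinom, h0, qShifted_succ]
          linear_combination (1 - q ^ (k + 1)) * h1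
        · have h2 := ih (k + 1) m (by omega)
          obtain rfl : n = k + 1 + m := by omega
          rw [qShifted_succ q m] at h1 ⊢
          rw [qShifted_succ q k] at h2 ⊢
          rw [gaussBinom, qShifted_succ q (k + 1 + m)]
          linear_combination (1 - q ^ (k + 1)) * h1 +
            q ^ (k + 1) * (1 - q ^ (m + 1)) * h2
  exact main (k + m) k m rfl

/-- The `q`-binomial coefficient `[n, a]_q` with an integer lower entry; it is zero unless
`a ∈ {0, …, n}`. -/
def qBin {R : Type*} [CommRing R] (q : R) (n : ℕ) (a : ℤ) : R :=
  if 0 ≤ a then gaussBinom q n a.toNat else 0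

theorem qBin_eq_zero {R : Type*} [CommRing R] (q : R) (n : ℕ) (a : ℤ)
    (ha : a < 0 ∨ (n : ℤ) < a) : qBin q n a = 0 := by
  unfold qBin
  split_ifs with h
  · exact gaussBinom_eq_zero q n _ (by omega)
  · rfl

/-- Finite formal sums `∑ c_e q^e` with integer coefficients `c_e` and real exponents `e`. -/
abbrev QExpr : Type := AddMonoidAlgebra ℤ ℝ

/-- The monomial `q^e`. -/
noncomputable def qPow (e : ℝ) : QExpr := AddMonoidAlgebra.single e 1

/-- The `j`-th term `(-1)^j q^{Kj((α+β)j+α-β)/2} [2L, L-Kj]_q`. -/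
noncomputable def bressoudTerm (L : ℕ) (α β : ℝ) (K : ℤ) (j : ℤ) : QExpr :=
  ((j.negOnePow : ℤˣ) : ℤ) •
    (qPow ((K : ℝ) * (j : ℝ) * ((α + β) * (j : ℝ) + α - β) / 2) *
      qBin (qPow 1) (2 * L) ((L : ℤ) - K * j))

/-- `G(L;α,β,K;q) = ∑_{j=-∞}^{∞} (-1)^j q^{Kj((α+β)j+α-β)/2} [2L, L-Kj]_q`. For `K ≠ 0` only
finitely many terms are nonzero, see `bressoudTerm_support_finite`. -/
noncomputable def bressoudG (L : ℕ) (α β : ℝ) (K : ℤ) : QExpr :=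
  ∑ᶠ j : ℤ, bressoudTerm L α β K j

theorem bressoudTerm_support_finite (L : ℕ) (α β : ℝ) (K : ℤ) (hK : K ≠ 0) :
    (Function.support (bressoudTerm L α β K)).Finite := by
  refine (Set.finite_Icc (-(L : ℤ)) L).subset fun j hj => ?_
  by_contra hj'
  apply hj
  have hLj : (L : ℤ) < |j| := by
    by_contra hle
    exact hj' (abs_le.mp (not_lt.mp hle))
  have h1 : (L : ℤ) < |K * j| := by
    rw [abs_mul]
    have hK1 : 1 ≤ |K| := Int.one_le_abs hK
    nlinarith [abs_nonneg j]
  have h2 : qBin (qPow 1) (2 * L) ((L : ℤ) - K * j) = 0 := by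
    apply qBin_eq_zero
    rcases lt_abs.mp h1 with h | h
    · left; omega
    · right; push_cast; omega
  simp [bressoudTerm, h2]

/-- `P(q) ≥ 0`: the expression `P` is a polynomial in `q` (natural number exponents only) all of
whose coefficients are nonnegative. -/
def NonnegPoly (P : QExpr) : Prop :=
  ∃ p : Polynomial ℤ, (∀ n : ℕ, 0 ≤ p.coeff n) ∧ Polynomial.aeval (qPow 1) p = P

/-! Everything rests on base changes for central `q`-binomials (`IsQBinBaseChange`): for suitable c,
k, a the function q^(a m²) [2L, L - c m]_q of m is a combination of the [2r, r - m]_{q^k}, with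
coefficients C(L - c r, r) that do not depend on m and are polynomials with nonnegative
coefficients. Put m = K j, multiply by the sign and the remaining power of q, and sum over j: G(L;
α', β', cK) becomes a combination with nonnegative kernel of the G(r; α, β, K) at q^k
(`nonnegPoly_bressoudG_of_baseChange`). The five claims are five such kernels.

The base changes are proved by induction on L. Going from L to L + 1 multiplies the central binomial
by a ratio whose denominator is affine in q^(cm) + q^(-cm) (`qBin_central_succ`). Multiplication by
p^m + p^(-m) is bidiagonal on the functions [2r, r - m]_p (`mul_sum_qBin`), so with p = q^c the
expansion reduces to a recurrence for C free of m (`isQBinBaseChange_of_recurrence`). The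
denominator vanishes only at c|m| = L + 1, where the expansion has a single term and is checked
directly. For base q⁴ with c = 2 the same method gives a three-term recurrence in L
(`isQBinBaseChange_quartic_of_recurrence`). All divisions take place in a field where q is nonzero
and not a root of unity; the result is pulled back from the fraction field of `QExpr`. -/

section GaussBinomRatios

/-! ### Ratios of neighbouring `q`-binomial coefficients. -/

variable {F : Type*} [Field F] {q : F}

theorem qShifted_self_ne_zero (hq : ∀ n : ℕ, 0 < n → q ^ n ≠ 1) (n : ℕ) :
    qShifted q q n ≠ 0 := by
  rw [qShifted, Finset.prod_ne_zero_iff]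
  intro j _ h
  apply hq (j + 1) j.succ_pos
  rw [pow_succ']
  linear_combination -h

theorem gaussBinom_self {R : Type*} [CommRing R] (q : R) (n : ℕ) : gaussBinom q n n = 1 := by
  induction n with
  | zero => simp [gaussBinom]
  | succ n ih => simp [gaussBinom, ih, gaussBinom_eq_zero]

theorem gaussBinom_zero_right {R : Type*} [CommRing R] (q : R) (n : ℕ) :
    gaussBinom q n 0 = 1 := by
  cases n <;> rfl

theorem gaussBinom_succ_mul (hq : ∀ n : ℕ, 0 < n → q ^ n ≠ 1) (k m : ℕ) :
    (1 - q ^ (m + 1)) * gaussBinom q (k + m + 1) k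
      = (1 - q ^ (k + m + 1)) * gaussBinom q (k + m) k := by
  have h1 := gaussBinom_closed q k m
  have h2 := gaussBinom_closed q k (m + 1)
  rw [← add_assoc, qShifted_succ, qShifted_succ] at h2
  apply mul_right_cancel₀ (mul_ne_zero (qShifted_self_ne_zero hq k) (qShifted_self_ne_zero hq m))
  linear_combination h2 - (1 - q ^ (k + m + 1)) * h1

theorem gaussBinom_succ_succ_mul (hq : ∀ n : ℕ, 0 < n → q ^ n ≠ 1) (n k : ℕ) :
    (1 - q ^ (k + 1)) * gaussBinom q (n + 1) (k + 1) = (1 - q ^ (n + 1)) * gaussBinom q n k := by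
  rcases lt_or_ge n k with h | h
  · rw [gaussBinom_eq_zero q n k h, gaussBinom_eq_zero q _ _ (by omega : n + 1 < k + 1)]
    ring
  · obtain ⟨m, rfl⟩ := Nat.exists_eq_add_of_le h
    have h1 := gaussBinom_closed q k m
    have h2 := gaussBinom_closed q (k + 1) m
    rw [show k + 1 + m = k + m + 1 by ring, qShifted_succ, qShifted_succ] at h2
    apply mul_right_cancel₀
      (mul_ne_zero (qShifted_self_ne_zero hq k) (qShifted_self_ne_zero hq m))
    linear_combination h2 - (1 - q ^ (k + m + 1)) * h1

theorem qBin_natCast {R : Type*} [CommRing R] (q : R) (n k : ℕ) :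
    qBin q n (k : ℤ) = gaussBinom q n k := by
  simp [qBin]

theorem qBin_succ_mul (hq : ∀ n : ℕ, 0 < n → q ^ n ≠ 1) (n : ℕ) (a : ℤ) :
    (1 - q ^ ((n : ℤ) + 1 - a)) * qBin q (n + 1) a = (1 - q ^ (n + 1)) * qBin q n a := by
  rcases lt_or_ge a 0 with h | h
  · rw [qBin_eq_zero q _ a (Or.inl h), qBin_eq_zero q _ a (Or.inl h)]
    ring
  lift a to ℕ using h
  rw [qBin_natCast, qBin_natCast]
  rcases lt_trichotomy a (n + 1) with h | h | h
  · obtain ⟨m, rfl⟩ := Nat.exists_eq_add_of_le (Nat.lt_succ_iff.mp h)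
    rw [← gaussBinom_succ_mul hq]
    congr 2
    rw [← zpow_natCast]
    congr 1
    push_cast
    ring
  · subst h
    rw [gaussBinom_eq_zero q n (n + 1) (by omega)]
    simp
  · rw [gaussBinom_eq_zero q _ _ h, gaussBinom_eq_zero q _ _ (by omega)]
    ring

theorem qBin_succ_succ_mul (hq : ∀ n : ℕ, 0 < n → q ^ n ≠ 1) (n : ℕ) (a : ℤ) :
    (1 - q ^ (a + 1)) * qBin q (n + 1) (a + 1) = (1 - q ^ (n + 1)) * qBin q n a := by
  rcases lt_trichotomy a (-1) with h | h | h
  · rw [qBin_eq_zero q _ _ (Or.inl (by omega : a + 1 < 0)), qBin_eq_zero q _ a (by omega)]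
    ring
  · subst h
    rw [qBin_eq_zero q _ _ (Or.inl (by omega : (-1 : ℤ) < 0))]
    simp
  · lift a to ℕ using (by omega)
    rw [qBin_natCast, ← gaussBinom_succ_succ_mul hq, ← qBin_natCast]
    norm_cast

/-- Raising the upper entry of a central `q`-binomial coefficient by two. -/
theorem qBin_central_succ (hq0 : q ≠ 0) (hq : ∀ n : ℕ, 0 < n → q ^ n ≠ 1) (n : ℕ) (m : ℤ) :
    (1 + q ^ (2 * n + 2) - q ^ (n + 1) * (q ^ m + q ^ (-m)))
        * qBin q (2 * (n + 1)) ((n + 1 : ℕ) - m)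
      = (1 - q ^ (2 * n + 1)) * (1 - q ^ (2 * n + 2)) * qBin q (2 * n) (n - m) := by
  have h1 := qBin_succ_succ_mul hq (2 * n + 1) (n - m)
  have h2 := qBin_succ_mul hq (2 * n) (n - m)
  have e1 : q ^ ((n : ℤ) - m + 1) = q ^ (n + 1) * q ^ (-m) := by
    rw [← zpow_natCast, ← zpow_add₀ hq0]
    congr 1
    push_cast
    ring
  have e2 : q ^ (((2 * n : ℕ) : ℤ) + 1 - (n - m)) = q ^ (n + 1) * q ^ m := by
    rw [← zpow_natCast, ← zpow_add₀ hq0]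
    congr 1
    push_cast
    ring
  rw [e1] at h1
  rw [e2] at h2
  have e3 : q ^ m * q ^ (-m) = 1 := by
    rw [← zpow_add₀ hq0]
    simp
  rw [show 2 * (n + 1) = 2 * n + 1 + 1 by ring,
    show ((n + 1 : ℕ) : ℤ) - m = (n : ℤ) - m + 1 by push_cast; ring]
  linear_combination (1 - q ^ (n + 1) * q ^ m) * h1 + (1 - q ^ (2 * n + 2)) * h2
    - q ^ (2 * n + 2) * qBin q (2 * n + 1 + 1) (n - m + 1) * e3

/-- The expression factors as (1 - q^(n+m)) (1 - q^(n-m)). It is the multiplier in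
`qBin_central_succ`, so this decides when that multiplier can be cancelled. -/
theorem one_add_sub_eq_zero_iff (hq0 : q ≠ 0) (hq : ∀ n : ℕ, 0 < n → q ^ n ≠ 1)
    (n : ℕ) (m : ℤ) :
    1 + q ^ (2 * n) - q ^ n * (q ^ m + q ^ (-m)) = 0 ↔ m.natAbs = n := by
  have hz : ∀ k : ℤ, q ^ k = 1 → k = 0 := by
    intro k hk
    by_contra hk0
    apply hq k.natAbs (Int.natAbs_pos.mpr hk0)
    rcases Int.natAbs_eq k with h | h
    · rw [h, zpow_natCast] at hk
      exact hk
    · rw [h, zpow_neg, zpow_natCast, inv_eq_one] at hk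
      exact hk
  have e3 : q ^ m * q ^ (-m) = 1 := by
    rw [← zpow_add₀ hq0]
    simp
  have key : 1 + q ^ (2 * n) - q ^ n * (q ^ m + q ^ (-m))
      = (1 - q ^ ((n : ℤ) + m)) * (1 - q ^ ((n : ℤ) + -m)) := by
    rw [zpow_add₀ hq0, zpow_add₀ hq0, zpow_natCast]
    linear_combination -q ^ (2 * n) * e3
  rw [key, mul_eq_zero, sub_eq_zero, sub_eq_zero]
  constructor
  · rintro (h | h)
    · have := hz _ h.symm
      omega
    · have := hz _ h.symm
      omega
  · intro h
    rcases Int.natAbs_eq m with h' | h'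
    · right
      rw [h', h]
      simp
    · left
      rw [h', h]
      simp

/-- Multiplication by `p^m + p^{-m}` acts bidiagonally on the central `p`-binomials. -/
theorem mul_sum_qBin {p : F} (hp0 : p ≠ 0) (hp : ∀ n : ℕ, 0 < n → p ^ n ≠ 1) (u v : F)
    (c : ℕ → F) (m : ℤ) (N : ℕ) (hc : c (N + 1) = 0) :
    (u - v * (p ^ m + p ^ (-m))) * ∑ r ∈ Finset.range (N + 1), c r * qBin p (2 * r) (r - m)
      = ∑ r ∈ Finset.range (N + 1),
          ((u - v * (p ^ r + (p ^ r)⁻¹)) * c r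
            + v * (p ^ (r + 1))⁻¹ * (1 - p ^ (2 * r + 1)) * (1 - p ^ (2 * r + 2)) * c (r + 1))
          * qBin p (2 * r) (r - m) := by
  -- Multiplication sends index r to r and r - 1, so the coefficient at r collects `c r` and `c (r +
  -- 1)`. The top index receives nothing from N + 1 and is kept apart; `hc` later puts it in the
  -- uniform shape.
  have main : ∀ N : ℕ, (u - v * (p ^ m + p ^ (-m)))
        * ∑ r ∈ Finset.range (N + 1), c r * qBin p (2 * r) (r - m)
      = ∑ r ∈ Finset.range N,
          ((u - v * (p ^ r + (p ^ r)⁻¹)) * c r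
            + v * (p ^ (r + 1))⁻¹ * (1 - p ^ (2 * r + 1)) * (1 - p ^ (2 * r + 2)) * c (r + 1))
          * qBin p (2 * r) (r - m)
        + (u - v * (p ^ N + (p ^ N)⁻¹)) * c N * qBin p (2 * N) (N - m) := by
    intro N
    induction N with
    | zero =>
      rcases eq_or_ne m 0 with rfl | hm
      · simp
        ring
      · simp [qBin_eq_zero p 0 (-m) (by omega)]
    | succ N ih =>
      have hs := qBin_central_succ hp0 hp N m
      rw [Finset.sum_range_succ, mul_add, ih, Finset.sum_range_succ]
      have hpN : p ^ (N + 1) ≠ 0 := pow_ne_zero _ hp0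
      have hinv : p ^ (N + 1) * (p ^ (N + 1))⁻¹ = 1 := mul_inv_cancel₀ hpN
      have e : p ^ (2 * N + 2) = p ^ (N + 1) * p ^ (N + 1) := by ring
      set B := qBin p (2 * (N + 1)) ((N + 1 : ℕ) - m)
      set B' := qBin p (2 * N) (N - m)
      set w := (p ^ (N + 1))⁻¹
      set P := p ^ (N + 1)
      rw [e] at hs ⊢
      linear_combination v * w * c (N + 1) * hs
        + c (N + 1) * B * v * (p ^ m + p ^ (-m) - P) * hinv
  rw [main N, Finset.sum_range_succ _ N, hc]
  ring

end GaussBinomRatios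

/-! ### Base changes from recurrences for their coefficients. -/

/-- The coefficient of the `r`-th term in an expansion of length `L`, indexed by `L - K r`. -/
def expCoeff {R : Type*} [CommRing R] (K : ℕ) (C : ℕ → ℕ → R) (L r : ℕ) : R :=
  if K * r ≤ L then C (L - K * r) r else 0

/-- `q^{a m²} [2L, L - K m]_q = ∑_r C(L - K r, r) [2r, r - m]_{q^k}` for all `L` and `m`. -/
def IsQBinBaseChange {R : Type*} [CommRing R] (q : R) (K k a : ℕ) (C : ℕ → ℕ → R) : Prop :=
  ∀ (L : ℕ) (m : ℤ), q ^ (a * m.natAbs ^ 2) * qBin q (2 * L) (L - K * m)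
    = ∑ r ∈ Finset.range (L + 1), expCoeff K C L r * qBin (q ^ k) (2 * r) (r - m)

section BaseChange

theorem expCoeff_add {R : Type*} [CommRing R] (K : ℕ) (C : ℕ → ℕ → R) (M r : ℕ) :
    expCoeff K C (K * r + M) r = C M r := by
  simp [expCoeff]

theorem expCoeff_of_lt {R : Type*} [CommRing R] {K : ℕ} (C : ℕ → ℕ → R) {L r : ℕ}
    (h : L < K * r) : expCoeff K C L r = 0 := by
  simp [expCoeff, h]

theorem expCoeff_succ_self {R : Type*} [CommRing R] {K : ℕ} (hK : 0 < K) (C : ℕ → ℕ → R)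
    (L : ℕ) : expCoeff K C L (L + 1) = 0 :=
  expCoeff_of_lt C (by nlinarith)

/-- Covers the case where the multiplier of the induction vanishes. Terms with r < |m| die because
the binomial does, terms with r > |m| because the coefficient does; at r = |m| both binomials are 1.
-/
theorem isQBinBaseChange_of_boundary {R : Type*} [CommRing R] {q : R} {K k a : ℕ} (hK : 0 < K)
    {C : ℕ → ℕ → R} (hC : ∀ r, C 0 r = q ^ (a * r ^ 2)) (L : ℕ) (m : ℤ)
    (hm : K * m.natAbs = L) :
    q ^ (a * m.natAbs ^ 2) * qBin q (2 * L) (L - K * m)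
      = ∑ r ∈ Finset.range (L + 1), expCoeff K C L r * qBin (q ^ k) (2 * r) (r - m) := by
  have hB : ∀ (x : R) (n : ℕ) (j : ℤ), j.natAbs = n → qBin x (2 * n) (n - j) = 1 := by
    intro x n j hj
    rcases Int.natAbs_eq j with h | h
    · rw [h, hj, sub_self]
      exact (qBin_natCast x _ 0).trans (gaussBinom_zero_right x _)
    · rw [h, hj, show (n : ℤ) - -(n : ℤ) = ((2 * n : ℕ) : ℤ) by push_cast; ring, qBin_natCast,
        gaussBinom_self]
  have hle : m.natAbs ≤ L := by nlinarith
  rw [Finset.sum_eq_single m.natAbs]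
  · have h1 := hB q L (K * m) (by rw [Int.natAbs_mul]; simpa using hm)
    rw [h1, hB _ _ _ rfl, ← hm, expCoeff, if_pos le_rfl, Nat.sub_self, hC]
  · intro r _ hr
    rcases lt_or_gt_of_ne hr with h | h
    · rw [qBin_eq_zero _ _ _ (by omega), mul_zero]
    · rw [expCoeff_of_lt C (by rw [← hm]; exact Nat.mul_lt_mul_of_pos_left h hK), zero_mul]
  · intro h
    exact absurd (Finset.mem_range.mpr (Nat.lt_succ_of_le hle)) h

theorem isQBinBaseChange_zero {R : Type*} [CommRing R] {q : R} {K k a : ℕ} (hK : 0 < K)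
    {C : ℕ → ℕ → R} (hC : ∀ r, C 0 r = q ^ (a * r ^ 2)) (m : ℤ) :
    q ^ (a * m.natAbs ^ 2) * qBin q (2 * 0) ((0 : ℕ) - K * m)
      = ∑ r ∈ Finset.range (0 + 1), expCoeff K C 0 r * qBin (q ^ k) (2 * r) (r - m) := by
  rcases eq_or_ne m 0 with rfl | hm
  · exact isQBinBaseChange_of_boundary hK hC 0 0 (by simp)
  · have h0 : (K : ℤ) * m ≠ 0 := mul_ne_zero (by exact_mod_cast hK.ne') hm
    rw [qBin_eq_zero q _ _ (by omega), Finset.sum_range_one, qBin_eq_zero _ _ _ (by omega)]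
    ring

variable {F : Type*} [Field F] {q : F}

theorem pow_ne_one_of_pos (hq : ∀ n : ℕ, 0 < n → q ^ n ≠ 1) {k : ℕ} (hk : 0 < k) (n : ℕ)
    (hn : 0 < n) : (q ^ k) ^ n ≠ 1 := by
  rw [← pow_mul]
  exact hq _ (Nat.mul_pos hk hn)

/-- For L = K r + M the first factor is (1 - q^(M+1)) (1 - q^(M+1+2Kr)), which turns the claim into
`hhigh`, or into `hlow` when L + 1 < K (r + 1) and the second term is absent. For L + 1 = K r that
factor is zero, which makes up for the vanishing right side. -/
theorem expCoeff_recurrence (hq0 : q ≠ 0) {K : ℕ} (hK : 0 < K) {C : ℕ → ℕ → F}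
    (hlow : ∀ M r, M + 1 < K →
      (1 - q ^ (2 * (K * r + M) + 1)) * (1 - q ^ (2 * (K * r + M) + 2)) * C M r
        = (1 - q ^ (M + 1)) * (1 - q ^ (M + 1 + 2 * (K * r))) * C (M + 1) r)
    (hhigh : ∀ M N r, M + 1 = N + K →
      (1 - q ^ (2 * (K * r + M) + 1)) * (1 - q ^ (2 * (K * r + M) + 2)) * C M r
        = (1 - q ^ (M + 1)) * (1 - q ^ (M + 1 + 2 * (K * r))) * C (M + 1) r
          + q ^ N * (1 - q ^ (K * (2 * r + 1))) * (1 - q ^ (K * (2 * r + 2))) * C N (r + 1))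
    (L r : ℕ) :
    (1 + q ^ (2 * (L + 1)) - q ^ (L + 1) * ((q ^ K) ^ r + ((q ^ K) ^ r)⁻¹)) * expCoeff K C (L + 1) r
      + q ^ (L + 1) * ((q ^ K) ^ (r + 1))⁻¹ * (1 - (q ^ K) ^ (2 * r + 1))
        * (1 - (q ^ K) ^ (2 * r + 2)) * expCoeff K C (L + 1) (r + 1)
      = (1 - q ^ (2 * L + 1)) * (1 - q ^ (2 * L + 2)) * expCoeff K C L r := by
  have hKr : K * (r + 1) = K * r + K := by ring
  have hinv : (q ^ K) ^ r * ((q ^ K) ^ r)⁻¹ = 1 :=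
    mul_inv_cancel₀ (pow_ne_zero _ (pow_ne_zero _ hq0))
  have hinv' : (q ^ K) ^ (r + 1) * ((q ^ K) ^ (r + 1))⁻¹ = 1 :=
    mul_inv_cancel₀ (pow_ne_zero _ (pow_ne_zero _ hq0))
  rcases lt_or_ge L (K * r) with h | h
  · rw [expCoeff_of_lt C h, expCoeff_of_lt C (by omega : L + 1 < K * (r + 1))]
    rcases eq_or_lt_of_le (Nat.succ_le_of_lt h) with h' | h'
    · have : q ^ (L + 1) = (q ^ K) ^ r := by rw [← pow_mul, ← h']
      rw [show 2 * (L + 1) = (L + 1) + (L + 1) by ring, pow_add, this]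
      linear_combination (-expCoeff K C (L + 1) r) * hinv
    · rw [expCoeff_of_lt C h']
      ring
  · obtain ⟨M, rfl⟩ := Nat.exists_eq_add_of_le h
    have e1 : q ^ (K * r + M + 1) * ((q ^ K) ^ r)⁻¹ = q ^ (M + 1) := by
      rw [add_assoc, pow_add, pow_mul]
      linear_combination q ^ (M + 1) * hinv
    rw [expCoeff_add, add_assoc, expCoeff_add]
    rcases lt_or_ge (M + 1) K with h' | h'
    · rw [expCoeff_of_lt C (by omega : K * r + (M + 1) < K * (r + 1)), hlow M r h', ← add_assoc]
      linear_combination (-C (M + 1) r) * e1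
    · obtain ⟨N, hN⟩ := Nat.exists_eq_add_of_le h'
      have e2 : q ^ (K * r + M + 1) * ((q ^ K) ^ (r + 1))⁻¹ = q ^ N := by
        rw [add_assoc, hN, ← add_assoc, ← hKr, pow_add, pow_mul]
        linear_combination q ^ N * hinv'
      rw [hhigh M N r (by omega), show K * r + (M + 1) = K * (r + 1) + N by omega, expCoeff_add,
        show K * (r + 1) + N = K * r + M + 1 by omega, ← pow_mul, ← pow_mul q K (2 * r + 1),
        ← pow_mul q K (2 * r + 2)]
      rw [← pow_mul] at e1
      linear_combination (-C (M + 1) r) * e1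
        + (1 - q ^ (K * (2 * r + 1))) * (1 - q ^ (K * (2 * r + 2))) * C N (r + 1) * e2

/-- Expansions `[2L, L - K m]_q` over `[2r, r - m]_{q^K}` are characterised by their values at
`L = K r` and a recurrence for the coefficients. -/
theorem isQBinBaseChange_of_recurrence (hq0 : q ≠ 0) (hq : ∀ n : ℕ, 0 < n → q ^ n ≠ 1) {K a : ℕ}
    (hK : 0 < K) {C : ℕ → ℕ → F} (hC : ∀ r, C 0 r = q ^ (a * r ^ 2))
    (hlow : ∀ M r, M + 1 < K →
      (1 - q ^ (2 * (K * r + M) + 1)) * (1 - q ^ (2 * (K * r + M) + 2)) * C M r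
        = (1 - q ^ (M + 1)) * (1 - q ^ (M + 1 + 2 * (K * r))) * C (M + 1) r)
    (hhigh : ∀ M N r, M + 1 = N + K →
      (1 - q ^ (2 * (K * r + M) + 1)) * (1 - q ^ (2 * (K * r + M) + 2)) * C M r
        = (1 - q ^ (M + 1)) * (1 - q ^ (M + 1 + 2 * (K * r))) * C (M + 1) r
          + q ^ N * (1 - q ^ (K * (2 * r + 1))) * (1 - q ^ (K * (2 * r + 2))) * C N (r + 1)) :
    IsQBinBaseChange q K K a C := by
  intro L
  induction L with
  | zero => exact isQBinBaseChange_zero hK hC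
  | succ L ih =>
    intro m
    rcases eq_or_ne (K * m.natAbs) (L + 1) with hm | hm
    · exact isQBinBaseChange_of_boundary hK hC (L + 1) m hm
    -- Off the boundary the multiplier is nonzero, so the identity may be proved after multiplying
    -- by it.
    have hf : 1 + q ^ (2 * (L + 1)) - q ^ (L + 1) * (q ^ (K * m) + q ^ (-(K * m))) ≠ 0 := by
      rw [Ne, one_add_sub_eq_zero_iff hq0 hq, Int.natAbs_mul]
      simpa using hm
    apply mul_left_cancel₀ hf
    have hs := qBin_central_succ hq0 hq L (K * m)
    have hm1 : q ^ ((K : ℤ) * m) = (q ^ K) ^ m := by rw [zpow_mul, zpow_natCast]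
    have hm2 : q ^ (-((K : ℤ) * m)) = (q ^ K) ^ (-m) := by
      rw [← mul_neg, zpow_mul, zpow_natCast]
    rw [show 2 * L + 2 = 2 * (L + 1) by ring] at hs
    rw [mul_left_comm, hs, mul_left_comm, ih m, hm1, hm2,
      mul_sum_qBin (pow_ne_zero K hq0) (pow_ne_one_of_pos hq hK) (1 + q ^ (2 * (L + 1)))
        (q ^ (L + 1)) (expCoeff K C (L + 1)) m (L + 1) (expCoeff_succ_self hK C (L + 1)),
      Finset.mul_sum]
    simp only [expCoeff_recurrence hq0 hK hlow hhigh]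
    rw [Finset.sum_range_succ _ (L + 1), expCoeff_succ_self hK C L]
    simp only [mul_zero, zero_mul, add_zero, mul_assoc]
    rfl

theorem expCoeff_quartic_recurrence (hq0 : q ≠ 0) {C : ℕ → ℕ → F}
    (hlow : ∀ r, (1 - q ^ 2) * (1 - q ^ (8 * r + 2)) * C 1 r
      = (1 - q ^ (4 * r + 1)) * (1 - q ^ (4 * r + 2)) * (1 + q) * (1 + q ^ (4 * r + 1)) * C 0 r)
    (hhigh : ∀ N r, (1 - q ^ (2 * N + 4)) * (1 - q ^ (2 * N + 4 + 8 * r)) * C (N + 2) r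
        + q ^ (2 * N) * (1 - q ^ (8 * r + 4)) * (1 - q ^ (8 * r + 8)) * C N (r + 1)
      = (1 - q ^ (2 * (2 * r + N) + 3)) * (1 - q ^ (2 * (2 * r + N) + 4))
        * ((1 + q) * (1 + q ^ (2 * (2 * r + N) + 3)) * C (N + 1) r
          - q * (1 - q ^ (2 * (2 * r + N) + 1)) * (1 - q ^ (2 * (2 * r + N) + 2)) * C N r))
    (L r : ℕ) :
    (1 + q ^ (4 * (L + 2)) - q ^ (2 * (L + 2)) * ((q ^ 4) ^ r + ((q ^ 4) ^ r)⁻¹))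
        * expCoeff 2 C (L + 2) r
      + q ^ (2 * (L + 2)) * ((q ^ 4) ^ (r + 1))⁻¹ * (1 - (q ^ 4) ^ (2 * r + 1))
        * (1 - (q ^ 4) ^ (2 * r + 2)) * expCoeff 2 C (L + 2) (r + 1)
      = (1 - q ^ (2 * L + 3)) * (1 - q ^ (2 * L + 4))
        * ((1 + q) * (1 + q ^ (2 * L + 3)) * expCoeff 2 C (L + 1) r
          - q * (1 - q ^ (2 * L + 1)) * (1 - q ^ (2 * L + 2)) * expCoeff 2 C L r) := by
  have hinv : (q ^ 4) ^ r * ((q ^ 4) ^ r)⁻¹ = 1 :=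
    mul_inv_cancel₀ (pow_ne_zero _ (pow_ne_zero _ hq0))
  have hinv' : (q ^ 4) ^ (r + 1) * ((q ^ 4) ^ (r + 1))⁻¹ = 1 :=
    mul_inv_cancel₀ (pow_ne_zero _ (pow_ne_zero _ hq0))
  rcases lt_or_ge (L + 2) (2 * r) with h | h
  · rw [expCoeff_of_lt C h, expCoeff_of_lt C (by omega : L + 2 < 2 * (r + 1)),
      expCoeff_of_lt C (by omega : L + 1 < 2 * r), expCoeff_of_lt C (by omega : L < 2 * r)]
    ring
  rcases eq_or_lt_of_le h with h | h
  · have e : q ^ (2 * (L + 2)) = (q ^ 4) ^ r := by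
      rw [← h]
      ring
    rw [expCoeff_of_lt C (by omega : L + 2 < 2 * (r + 1)),
      expCoeff_of_lt C (by omega : L + 1 < 2 * r), expCoeff_of_lt C (by omega : L < 2 * r),
      show 4 * (L + 2) = 2 * (L + 2) + 2 * (L + 2) by ring, pow_add, e]
    linear_combination (-expCoeff 2 C (L + 2) r) * hinv
  rcases eq_or_lt_of_le (Nat.succ_le_of_lt h) with h | h
  · have h1 := expCoeff_add 2 C 0 r
    have h2 := expCoeff_add 2 C 1 r
    rw [show 2 * r + 0 = L + 1 by omega] at h1
    rw [show 2 * r + 1 = L + 2 by omega] at h2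
    have e : q ^ (2 * (L + 2)) = q ^ 2 * (q ^ 4) ^ r := by
      rw [show L + 2 = 2 * r + 1 by omega]
      ring
    have e' : q ^ (2 * L + 3) = q * (q ^ 4) ^ r := by
      rw [show 2 * L + 3 = 4 * r + 1 by omega]
      ring
    have e'' : q ^ (2 * L + 4) = q ^ 2 * (q ^ 4) ^ r := by
      rw [← e]
      ring
    rw [expCoeff_of_lt C (by omega : L + 2 < 2 * (r + 1)), expCoeff_of_lt C (by omega : L < 2 * r),
      h1, h2, show 4 * (L + 2) = 2 * (L + 2) + 2 * (L + 2) by ring, pow_add, e, e', e'']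
    linear_combination hlow r - q ^ 2 * C 1 r * hinv
  · obtain ⟨N, hN⟩ := Nat.exists_eq_add_of_le (by omega : 2 * r ≤ L)
    subst hN
    have h0 := expCoeff_add 2 C N r
    have h1 := expCoeff_add 2 C (N + 1) r
    have h2 := expCoeff_add 2 C (N + 2) r
    have h3 := expCoeff_add 2 C N (r + 1)
    rw [← add_assoc] at h1 h2
    rw [show 2 * (r + 1) + N = 2 * r + N + 2 by ring] at h3
    rw [h0, h1, h2, h3, ← hhigh]
    linear_combination (-q ^ (2 * N + 4)) * C (N + 2) r * hinv
      + q ^ (2 * N) * (1 - q ^ (8 * r + 4)) * (1 - q ^ (8 * r + 8)) * C N (r + 1) * hinv'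

/-- Expansions of `[2L, L - 2m]_q` over `[2r, r - m]_{q^4}`. -/
theorem isQBinBaseChange_quartic_of_recurrence (hq0 : q ≠ 0) (hq : ∀ n : ℕ, 0 < n → q ^ n ≠ 1)
    {C : ℕ → ℕ → F} (hC : ∀ r, C 0 r = 1) (hC1 : C 1 0 = 1 + q)
    (hlow : ∀ r, (1 - q ^ 2) * (1 - q ^ (8 * r + 2)) * C 1 r
      = (1 - q ^ (4 * r + 1)) * (1 - q ^ (4 * r + 2)) * (1 + q) * (1 + q ^ (4 * r + 1)) * C 0 r)
    (hhigh : ∀ N r, (1 - q ^ (2 * N + 4)) * (1 - q ^ (2 * N + 4 + 8 * r)) * C (N + 2) r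
        + q ^ (2 * N) * (1 - q ^ (8 * r + 4)) * (1 - q ^ (8 * r + 8)) * C N (r + 1)
      = (1 - q ^ (2 * (2 * r + N) + 3)) * (1 - q ^ (2 * (2 * r + N) + 4))
        * ((1 + q) * (1 + q ^ (2 * (2 * r + N) + 3)) * C (N + 1) r
          - q * (1 - q ^ (2 * (2 * r + N) + 1)) * (1 - q ^ (2 * (2 * r + N) + 2)) * C N r)) :
    IsQBinBaseChange q 2 4 0 C := by
  have hC' : ∀ r, C 0 r = q ^ (0 * r ^ 2) := by
    intro r
    rw [hC, zero_mul, pow_zero]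
  intro L
  induction L using Nat.twoStepInduction with
  | zero => exact isQBinBaseChange_zero two_pos hC'
  | one =>
    -- A recurrence of order two in L needs a second initial row; at L = 1 only m = 0 contributes,
    -- with [2, 1]_q = 1 + q.
    intro m
    rw [Finset.sum_range_succ, Finset.sum_range_one, expCoeff_of_lt C (by norm_num : 1 < 2 * 1)]
    rcases eq_or_ne m 0 with rfl | hm
    · simp [expCoeff, hC1, qBin, gaussBinom]
    · rw [qBin_eq_zero q _ _ (by omega), qBin_eq_zero _ (2 * 0) _ (by omega)]
      ring
  | more L ih0 ih1 =>
    intro m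
    rcases eq_or_ne (2 * m.natAbs) (L + 2) with hm | hm
    · exact isQBinBaseChange_of_boundary two_pos hC' (L + 2) m hm
    have hx1 : (q ^ 4) ^ m = q ^ (2 * m) * q ^ (2 * m) := by
      rw [← zpow_natCast, ← zpow_mul, ← zpow_add₀ hq0]
      congr 1
      push_cast
      ring
    have hx2 : (q ^ 4) ^ (-m) = q ^ (-(2 * m)) * q ^ (-(2 * m)) := by
      rw [← zpow_natCast, ← zpow_mul, ← zpow_add₀ hq0]
      congr 1
      push_cast
      ring
    have hy : q ^ (2 * m) * q ^ (-(2 * m)) = 1 := by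
      rw [← zpow_add₀ hq0]
      simp
    -- With Q = q^(L+2) and s = q^(2m) + q^(-2m) this multiplier is (1 + Q² - Q s) (1 + Q² + Q s):
    -- the central multiplier times its conjugate, hence affine in q^(4m) + q^(-4m).
    have hf : 1 + q ^ (4 * (L + 2)) - q ^ (2 * (L + 2)) * ((q ^ 4) ^ m + (q ^ 4) ^ (-m)) ≠ 0 := by
      have := one_add_sub_eq_zero_iff (pow_ne_zero 2 hq0) (pow_ne_one_of_pos hq two_pos) (L + 2)
        (2 * m)
      rw [← pow_mul, ← pow_mul, ← mul_assoc, show 2 * 2 = 4 from rfl] at this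
      have e1 : (q ^ 2) ^ (2 * m) = (q ^ 4) ^ m := by
        rw [← zpow_natCast, ← zpow_natCast, ← zpow_mul, ← zpow_mul]
        congr 1
        push_cast
        ring
      have e2 : (q ^ 2) ^ (-(2 * m)) = (q ^ 4) ^ (-m) := by
        rw [zpow_neg, e1, zpow_neg]
      rw [e1, e2] at this
      rw [Ne, this, Int.natAbs_mul]
      exact hm
    apply mul_left_cancel₀ hf
    have hs0 := qBin_central_succ hq0 hq L (2 * m)
    have hs1 := qBin_central_succ hq0 hq (L + 1) (2 * m)
    have i0 := ih0 m
    have i1 := ih1 m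
    rw [zero_mul, pow_zero, one_mul] at i0 i1 ⊢
    rw [mul_sum_qBin (pow_ne_zero 4 hq0) (pow_ne_one_of_pos hq four_pos) (1 + q ^ (4 * (L + 2)))
        (q ^ (2 * (L + 2))) (expCoeff 2 C (L + 2)) m (L + 2)
        (expCoeff_succ_self two_pos C (L + 2))]
    simp only [expCoeff_quartic_recurrence hq0 hlow hhigh]
    have s0 : ∑ r ∈ Finset.range (L + 2 + 1), expCoeff 2 C L r * qBin (q ^ 4) (2 * r) (r - m)
        = qBin q (2 * L) (L - (2 : ℕ) * m) := by
      rw [i0, Finset.sum_range_succ, Finset.sum_range_succ, expCoeff_of_lt C (by omega),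
        expCoeff_of_lt C (by omega)]
      ring
    have s1 : ∑ r ∈ Finset.range (L + 2 + 1), expCoeff 2 C (L + 1) r * qBin (q ^ 4) (2 * r) (r - m)
        = qBin q (2 * (L + 1)) ((L + 1 : ℕ) - (2 : ℕ) * m) := by
      rw [i1, Finset.sum_range_succ, expCoeff_of_lt C (by omega)]
      ring
    have s : ∀ r : ℕ, (1 - q ^ (2 * L + 3)) * (1 - q ^ (2 * L + 4))
          * ((1 + q) * (1 + q ^ (2 * L + 3)) * expCoeff 2 C (L + 1) r
            - q * (1 - q ^ (2 * L + 1)) * (1 - q ^ (2 * L + 2)) * expCoeff 2 C L r)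
          * qBin (q ^ 4) (2 * r) (r - m)
        = (1 - q ^ (2 * L + 3)) * (1 - q ^ (2 * L + 4)) * (1 + q) * (1 + q ^ (2 * L + 3))
            * (expCoeff 2 C (L + 1) r * qBin (q ^ 4) (2 * r) (r - m))
          - (1 - q ^ (2 * L + 3)) * (1 - q ^ (2 * L + 4)) * q * (1 - q ^ (2 * L + 1))
            * (1 - q ^ (2 * L + 2)) * (expCoeff 2 C L r * qBin (q ^ 4) (2 * r) (r - m)) := by
      intro r
      ring
    rw [Finset.sum_congr rfl fun r _ => s r, Finset.sum_sub_distrib, ← Finset.mul_sum,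
      ← Finset.mul_sum, s0, s1, hx1, hx2]
    push_cast at hs0 hs1 ⊢
    rw [show (L : ℤ) + 1 + 1 = L + 2 by ring] at hs1
    set B0 := qBin q (2 * L) (L - 2 * m)
    set B1 := qBin q (2 * (L + 1)) (L + 1 - 2 * m)
    change _ * qBin q (2 * (L + 2)) _ = _ at hs1
    set B2 := qBin q (2 * (L + 2)) (L + 2 - 2 * m)
    set y := q ^ (2 * m)
    set y' := q ^ (-(2 * m))
    -- The conjugate factor applied to `hs1` leaves a term (y + y') B1, which `hs0` replaces by B1
    -- and B0.
    linear_combination (1 + q ^ (2 * L + 4) + q ^ (L + 2) * (y + y')) * hs1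
      - q * (1 - q ^ (2 * L + 3)) * (1 - q ^ (2 * L + 4)) * hs0
      + 2 * q ^ (2 * L + 4) * B2 * hy

end BaseChange

/-! ### The five kernels. -/

section Kernels

variable {R : Type*} [CommRing R]

/-- Kernel of the expansion of `q^{2m²} [2L, L - 2m]_q` over base `q²`. -/
def quadKernelA (q : R) (M r : ℕ) : R :=
  q ^ (2 * r ^ 2) * (∏ i ∈ Finset.range M, (1 + q ^ (2 * r + 1 + i)))
    * gaussBinom q (2 * r + M) (2 * r)

/-- Kernel of the expansion of `[2L, L - 2m]_q` over base `q²`. -/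
def quadKernelB (q : R) (M r : ℕ) : R :=
  q ^ (M.choose 2) * (∏ i ∈ Finset.range M, (1 + q ^ (2 * r + 1 + i)))
    * gaussBinom q (2 * r + M) (2 * r)

/-- Kernel of the expansion of `q^{m²} [2L, L - 2m]_q` over base `q²`. -/
def quadKernelC (q : R) : ℕ → ℕ → R
  | 0, r => q ^ r ^ 2
  | M + 1, r => q ^ r ^ 2 * (1 + q ^ (2 * r + M + 1))
      * (∏ i ∈ Finset.range M, (1 + q ^ (2 * (r + 1 + i))))
      * gaussBinom q (2 * r + (M + 1)) (2 * r)

/-- Kernel of the expansion of `[2L, L - 2m]_q` over base `q⁴`. -/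
def quarticKernel (q : R) (M r : ℕ) : R :=
  (∏ i ∈ Finset.range M, (q + q ^ (2 * i))) * gaussBinom (q ^ 2) (2 * r + M) (2 * r)

/-- Kernel of the expansion of `q^{3m²} [2L, L - 3m]_q` over base `q³`. -/
def cubicKernel (q : R) : ℕ → ℕ → R
  | 0, r => q ^ (3 * r ^ 2)
  | M + 1, r => q ^ (3 * r ^ 2)
      * (gaussBinom (q ^ 3) (2 * r + M) (2 * r)
          * (∏ i ∈ Finset.range M, (1 + q ^ (i + 1) + q ^ (2 * (i + 1)))) * (1 + q ^ (M + 1))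
        + q ^ (2 * (M + 1)) * qBin (q ^ 3) (2 * r + M) (2 * r - 1)
          * ∏ i ∈ Finset.range (M + 1), (1 + q ^ (i + 1) + q ^ (2 * (i + 1))))

end Kernels

/-! ### The kernels satisfy the recurrences. -/

section KernelExpansions

variable {F : Type*} [Field F] {q : F}

theorem one_sub_pow_ne_zero (hq : ∀ n : ℕ, 0 < n → q ^ n ≠ 1) (n : ℕ) : 1 - q ^ (n + 1) ≠ 0 :=
  fun h => hq (n + 1) n.succ_pos (sub_eq_zero.mp h).symm

/-- Trades (r + 1, N) for (r, N + 1), so that the terms of the kernel recurrences can be brought to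
a common `q`-binomial. -/
theorem gaussBinom_shift_mul (hq : ∀ n : ℕ, 0 < n → q ^ n ≠ 1) (r N : ℕ) :
    (1 - q ^ (2 * r + 1)) * (1 - q ^ (2 * r + 2)) * gaussBinom q (2 * (r + 1) + N) (2 * (r + 1))
      = (1 - q ^ (2 * r + N + 2)) * (1 - q ^ (N + 1))
        * gaussBinom q (2 * r + (N + 1)) (2 * r) := by
  have h1 := gaussBinom_succ_succ_mul hq (2 * r + N + 1) (2 * r + 1)
  have h2 := gaussBinom_succ_succ_mul hq (2 * r + N) (2 * r)
  have h3 := gaussBinom_succ_mul hq (2 * r) N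
  rw [show 2 * (r + 1) + N = 2 * r + N + 1 + 1 by ring, show 2 * (r + 1) = 2 * r + 1 + 1 by ring,
    ← add_assoc]
  linear_combination (1 - q ^ (2 * r + 1)) * h1 + (1 - q ^ (2 * r + N + 2)) * h2
    - (1 - q ^ (2 * r + N + 2)) * h3

/-- Both sides are the product of 1 + q^(2r+1+i) over i < N + 2. -/
theorem prod_quad_shift {R : Type*} [CommRing R] (q : R) (r N : ℕ) :
    (1 + q ^ (2 * r + 1)) * (1 + q ^ (2 * r + 2))
        * ∏ i ∈ Finset.range N, (1 + q ^ (2 * (r + 1) + 1 + i))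
      = (1 + q ^ (2 * r + N + 2)) * ∏ i ∈ Finset.range (N + 1), (1 + q ^ (2 * r + 1 + i)) := by
  rw [show 2 * r + N + 2 = 2 * r + 1 + (N + 1) by ring,
    mul_comm (1 + q ^ (2 * r + 1 + (N + 1))), ← Finset.prod_range_succ,
    Finset.prod_range_succ', Finset.prod_range_succ',
    Finset.prod_congr rfl fun i _ => by
      rw [show 2 * (r + 1) + 1 + i = 2 * r + 1 + (i + 1 + 1) by ring]]
  ring

theorem quadKernelA_isQBinBaseChange (hq0 : q ≠ 0) (hq : ∀ n : ℕ, 0 < n → q ^ n ≠ 1) :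
    IsQBinBaseChange q 2 2 2 (quadKernelA q) := by
  apply isQBinBaseChange_of_recurrence hq0 hq two_pos
  · simp [quadKernelA, gaussBinom_self]
  · intro M r hM
    obtain rfl : M = 0 := by omega
    have h := gaussBinom_succ_mul hq (2 * r) 0
    simp only [quadKernelA, Finset.prod_range_succ, Finset.prod_range_zero]
    linear_combination (-(1 + q ^ (2 * r + 1)) * (1 - q ^ (1 + 2 * (2 * r))) * q ^ (2 * r ^ 2)) * h
  · intro M N r hM
    obtain rfl : M = N + 1 := by omega
    have h1 := gaussBinom_succ_mul hq (2 * r) (N + 1)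
    have h2 := gaussBinom_shift_mul hq r N
    have h3 := prod_quad_shift q r N
    simp only [quadKernelA, Finset.prod_range_succ _ (N + 1), ← add_assoc] at *
    set P := ∏ i ∈ Finset.range (N + 1), (1 + q ^ (2 * r + 1 + i))
    set P' := ∏ i ∈ Finset.range N, (1 + q ^ (2 * (r + 1) + 1 + i))
    set g := gaussBinom q (2 * r + N + 1) (2 * r)
    set g' := gaussBinom q (2 * (r + 1) + N) (2 * (r + 1))
    -- `h1` brings the M + 1 term, and `h2` with `h3` the N term, to the common factor P g; a
    -- polynomial identity in powers of q remains.
    linear_combination (-(1 - q ^ (N + 2 + 4 * r)) * q ^ (2 * r ^ 2) * P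
        * (1 + q ^ (2 * r + N + 2))) * h1
      - q ^ N * q ^ (2 * (r + 1) ^ 2) * (1 + q ^ (2 * r + 1)) * (1 + q ^ (2 * r + 2)) * P' * h2
      - q ^ N * q ^ (2 * (r + 1) ^ 2) * (1 - q ^ (2 * r + N + 2)) * (1 - q ^ (N + 1)) * g * h3

theorem quadKernelB_isQBinBaseChange (hq0 : q ≠ 0) (hq : ∀ n : ℕ, 0 < n → q ^ n ≠ 1) :
    IsQBinBaseChange q 2 2 0 (quadKernelB q) := by
  apply isQBinBaseChange_of_recurrence hq0 hq two_pos
  · simp [quadKernelB, gaussBinom_self]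
  · intro M r hM
    obtain rfl : M = 0 := by omega
    have h := gaussBinom_succ_mul hq (2 * r) 0
    simp only [quadKernelB, Finset.prod_range_succ, Finset.prod_range_zero]
    simp only [Nat.choose_zero_succ, zero_add, Nat.choose_succ_self]
    linear_combination (-(1 + q ^ (2 * r + 1)) * (1 - q ^ (1 + 2 * (2 * r)))) * h
  · intro M N r hM
    obtain rfl : M = N + 1 := by omega
    have h1 := gaussBinom_succ_mul hq (2 * r) (N + 1)
    have h2 := gaussBinom_shift_mul hq r N
    have h3 := prod_quad_shift q r N
    have c1 : (N + 1).choose 2 = N + N.choose 2 := by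
      rw [Nat.choose_succ_succ' N 1, Nat.choose_one_right]
    have c2 : (N + 1 + 1).choose 2 = N + 1 + (N + N.choose 2) := by
      rw [Nat.choose_succ_succ' (N + 1) 1, Nat.choose_one_right, c1]
    simp only [quadKernelB, Finset.prod_range_succ _ (N + 1), c1, c2]
    simp only [← add_assoc] at *
    set P := ∏ i ∈ Finset.range (N + 1), (1 + q ^ (2 * r + 1 + i))
    set P' := ∏ i ∈ Finset.range N, (1 + q ^ (2 * (r + 1) + 1 + i))
    set g := gaussBinom q (2 * r + N + 1) (2 * r)
    set g' := gaussBinom q (2 * (r + 1) + N) (2 * (r + 1))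
    linear_combination (-(1 - q ^ (N + 2 + 4 * r)) * q ^ (N + 1 + N + N.choose 2) * P
        * (1 + q ^ (2 * r + N + 2))) * h1
      - q ^ N * q ^ (N.choose 2) * (1 + q ^ (2 * r + 1)) * (1 + q ^ (2 * r + 2)) * P' * h2
      - q ^ N * q ^ (N.choose 2) * (1 - q ^ (2 * r + N + 2)) * (1 - q ^ (N + 1)) * g * h3

theorem quadKernelC_isQBinBaseChange (hq0 : q ≠ 0) (hq : ∀ n : ℕ, 0 < n → q ^ n ≠ 1) :
    IsQBinBaseChange q 2 2 1 (quadKernelC q) := by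
  apply isQBinBaseChange_of_recurrence hq0 hq two_pos
  · simp [quadKernelC]
  · intro M r hM
    obtain rfl : M = 0 := by omega
    have h := gaussBinom_succ_mul hq (2 * r) 0
    rw [add_zero, gaussBinom_self] at h
    simp only [quadKernelC, Finset.prod_range_zero]
    linear_combination (-(1 + q ^ (2 * r + 1)) * (1 - q ^ (1 + 2 * (2 * r))) * q ^ (r ^ 2)) * h
  · intro M N r hM
    obtain rfl : M = N + 1 := by omega
    have h1 := gaussBinom_succ_mul hq (2 * r) (N + 1)
    have h2 := gaussBinom_shift_mul hq r N
    -- The extra factor supplies the missing first factor of the product, giving one formula for N =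
    -- 0 and N > 0.
    have h3 : (1 + q ^ (2 * r + 2)) * quadKernelC q N (r + 1)
        = q ^ (r + 1) ^ 2 * (1 + q ^ (2 * r + N + 2))
          * (∏ i ∈ Finset.range N, (1 + q ^ (2 * (r + 1 + i))))
          * gaussBinom q (2 * (r + 1) + N) (2 * (r + 1)) := by
      rcases N with _ | N
      · simp [quadKernelC, gaussBinom_self]
        ring
      · rw [quadKernelC, Finset.prod_range_succ',
          Finset.prod_congr rfl fun i _ => by
            rw [show r + 1 + 1 + i = r + 1 + (i + 1) by ring]]
        ring
    rw [quadKernelC, quadKernelC, Finset.prod_range_succ]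
    simp only [← add_assoc] at *
    set P := ∏ i ∈ Finset.range N, (1 + q ^ (2 * (r + 1 + i)))
    set g := gaussBinom q (2 * r + N + 1) (2 * r)
    set g' := gaussBinom q (2 * (r + 1) + N) (2 * (r + 1))
    linear_combination (-(1 - q ^ (N + 2 + 4 * r)) * q ^ (r ^ 2) * P
        * (1 + q ^ (2 * r + N + 2)) * (1 + q ^ (2 * (r + 1 + N)))) * h1
      - q ^ N * (1 - q ^ (4 * r + 2)) * (1 - q ^ (2 * r + 2)) * h3
      - q ^ N * q ^ ((r + 1) ^ 2) * (1 + q ^ (2 * r + 1)) * (1 + q ^ (2 * r + N + 2)) * P * h2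

theorem quarticKernel_isQBinBaseChange (hq0 : q ≠ 0) (hq : ∀ n : ℕ, 0 < n → q ^ n ≠ 1) :
    IsQBinBaseChange q 2 4 0 (quarticKernel q) := by
  have hq2 := pow_ne_one_of_pos hq two_pos
  apply isQBinBaseChange_quartic_of_recurrence hq0 hq
  · simp [quarticKernel, gaussBinom_self]
  · simp [quarticKernel, gaussBinom_zero_right]
    ring
  · intro r
    have h := gaussBinom_succ_mul hq2 (2 * r) 0
    simp only [quarticKernel, Finset.prod_range_succ, Finset.prod_range_zero]
    linear_combination ((1 - q ^ (8 * r + 2)) * (1 + q)) * h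
  · intro N r
    have h0 := gaussBinom_succ_mul hq2 (2 * r) N
    have h1 := gaussBinom_succ_mul hq2 (2 * r) (N + 1)
    have h2 := gaussBinom_shift_mul hq2 r N
    simp only [quarticKernel, Finset.prod_range_succ _ (N + 1), Finset.prod_range_succ _ N]
    simp only [← add_assoc] at *
    set P := ∏ i ∈ Finset.range N, (q + q ^ (2 * i))
    set g := gaussBinom (q ^ 2) (2 * r + N) (2 * r)
    set g1 := gaussBinom (q ^ 2) (2 * r + N + 1) (2 * r)
    linear_combination ((1 - q ^ (2 * N + 4 + 8 * r)) * P * (q + q ^ (2 * N))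
        * (q + q ^ (2 * (N + 1)))) * h1
      + q ^ (2 * N) * (1 + q ^ (4 * r + 2)) * (1 + q ^ (4 * r + 4)) * P * h2
      - q * (1 - q ^ (2 * (2 * r + N) + 3)) * (1 - q ^ (2 * (2 * r + N) + 4))
        * (1 - q ^ (2 * (2 * r + N) + 1)) * P * h0

/-- The product form suited to the recurrence. Dividing it by 1 - q^(M+1) hides positivity, which is
why the kernel is defined as a sum of two visibly nonnegative terms. -/
theorem one_sub_pow_mul_cubicKernel (hq : ∀ n : ℕ, 0 < n → q ^ n ≠ 1) (M r : ℕ) :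
    (1 - q ^ (M + 1)) * cubicKernel q (M + 1) r
      = q ^ (3 * r ^ 2) * gaussBinom (q ^ 3) (2 * r + M) (2 * r)
        * (∏ i ∈ Finset.range M, (1 + q ^ (i + 1) + q ^ (2 * (i + 1))))
        * (1 - q ^ (6 * r + 2 * M + 2)) := by
  have hq3 := pow_ne_one_of_pos hq three_pos
  have h : (1 - q ^ (3 * M + 3)) * qBin (q ^ 3) (2 * r + M) (2 * r - 1)
      = (1 - q ^ (6 * r)) * gaussBinom (q ^ 3) (2 * r + M) (2 * r) := by
    rcases r with _ | r
    · rw [qBin_eq_zero _ _ _ (by simp)]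
      simp
    · have h1 := gaussBinom_succ_succ_mul hq3 (2 * r + 1 + M) (2 * r + 1)
      have h2 := gaussBinom_succ_mul hq3 (2 * r + 1) M
      rw [show (2 * ((r + 1 : ℕ) : ℤ) - 1) = ((2 * r + 1 : ℕ) : ℤ) by push_cast; ring,
        qBin_natCast, show 2 * (r + 1) + M = 2 * r + 1 + M + 1 by ring,
        show 2 * (r + 1) = 2 * r + 1 + 1 by ring]
      linear_combination h2 - h1
  rw [cubicKernel, Finset.prod_range_succ]
  linear_combination (q ^ (3 * r ^ 2) * q ^ (2 * (M + 1))
    * ∏ i ∈ Finset.range M, (1 + q ^ (i + 1) + q ^ (2 * (i + 1)))) * h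

theorem cubicKernel_isQBinBaseChange (hq0 : q ≠ 0) (hq : ∀ n : ℕ, 0 < n → q ^ n ≠ 1) :
    IsQBinBaseChange q 3 3 3 (cubicKernel q) := by
  have hq3 := pow_ne_one_of_pos hq three_pos
  have hlow1 : ∀ r, (1 - q) * cubicKernel q 1 r = q ^ (3 * r ^ 2) * (1 - q ^ (6 * r + 2)) := by
    intro r
    simpa [gaussBinom_self] using one_sub_pow_mul_cubicKernel hq 0 r
  apply isQBinBaseChange_of_recurrence hq0 hq three_pos
  · simp [cubicKernel]
  · intro M r hM
    obtain rfl | rfl : M = 0 ∨ M = 1 := by omega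
    · rw [cubicKernel]
      linear_combination (-(1 - q ^ (6 * r + 1))) * hlow1 r
    · have h2 := one_sub_pow_mul_cubicKernel hq 1 r
      have h := gaussBinom_succ_mul hq3 (2 * r) 0
      rw [Finset.prod_range_one] at h2
      rw [add_zero, gaussBinom_self] at h
      apply mul_left_cancel₀ (one_sub_pow_ne_zero hq 0)
      linear_combination (1 - q ^ (6 * r + 3)) * (1 - q ^ (6 * r + 4)) * hlow1 r
        - (1 - q) * (1 - q ^ (6 * r + 2)) * h2
        - q ^ (3 * r ^ 2) * (1 - q ^ (6 * r + 4)) * (1 - q ^ (6 * r + 2)) * h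
  · intro M N r hM
    obtain rfl : M = N + 2 := by omega
    have hM1 := one_sub_pow_mul_cubicKernel hq (N + 1) r
    have hM2 := one_sub_pow_mul_cubicKernel hq (N + 2) r
    have hg := gaussBinom_succ_mul hq3 (2 * r) (N + 1)
    -- The analogue for (r + 1, N) in terms of (r, N + 1), uniform in N although the kernel is
    -- defined by cases.
    have hN : (1 - q ^ (6 * r + 3)) * (1 - q ^ (6 * r + 6)) * cubicKernel q N (r + 1)
        = q ^ (3 * (r + 1) ^ 2) * (1 - q ^ (6 * r + 2 * N + 6)) * (1 - q ^ (N + 1))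
          * gaussBinom (q ^ 3) (2 * r + (N + 1)) (2 * r)
          * ∏ i ∈ Finset.range (N + 1), (1 + q ^ (i + 1) + q ^ (2 * (i + 1))) := by
      rcases N with _ | N
      · have h := gaussBinom_succ_mul hq3 (2 * r) 0
        rw [add_zero, gaussBinom_self] at h
        rw [cubicKernel, Finset.prod_range_one]
        linear_combination (-q ^ (3 * (r + 1) ^ 2) * (1 - q ^ (6 * r + 6))) * h
      · have h1 := one_sub_pow_mul_cubicKernel hq N (r + 1)
        have h2 := gaussBinom_shift_mul hq3 r N
        have h3 := gaussBinom_succ_mul hq3 (2 * r) (N + 1)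
        rw [Finset.prod_range_succ, Finset.prod_range_succ]
        apply mul_left_cancel₀ (one_sub_pow_ne_zero hq N)
        set P := ∏ i ∈ Finset.range N, (1 + q ^ (i + 1) + q ^ (2 * (i + 1)))
        simp only [← add_assoc] at *
        set g := gaussBinom (q ^ 3) (2 * r + N + 1) (2 * r)
        linear_combination (1 - q ^ (6 * r + 3)) * (1 - q ^ (6 * r + 6)) * h1
          + q ^ (3 * (r + 1) ^ 2) * P * (1 - q ^ (6 * r + 2 * N + 8)) * h2
          - q ^ (3 * (r + 1) ^ 2) * P * (1 - q ^ (6 * r + 2 * N + 8))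
            * (1 - q ^ (3 * (N + 1))) * h3
    rw [Finset.prod_range_succ] at hM2
    apply mul_left_cancel₀ (one_sub_pow_ne_zero hq (N + 1))
    simp only [← add_assoc] at *
    set P := ∏ i ∈ Finset.range (N + 1), (1 + q ^ (i + 1) + q ^ (2 * (i + 1)))
    set g := gaussBinom (q ^ 3) (2 * r + N + 1) (2 * r)
    linear_combination (1 - q ^ (6 * r + 2 * N + 5)) * (1 - q ^ (6 * r + 2 * N + 6)) * hM1
      - (1 - q ^ (N + 2)) * (1 - q ^ (N + 3 + 6 * r)) * hM2
      - (1 - q ^ (N + 3 + 6 * r)) * q ^ (3 * r ^ 2) * P * (1 - q ^ (6 * r + 2 * N + 6)) * hg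
      - (1 - q ^ (N + 2)) * q ^ N * hN

end KernelExpansions

/-! ### Compatibility with ring homomorphisms. -/

section Transfer

variable {R S : Type*} [CommRing R] [CommRing S] (f : R →+* S)

theorem map_gaussBinom (q : R) (n k : ℕ) : f (gaussBinom q n k) = gaussBinom (f q) n k := by
  induction n generalizing k with
  | zero => cases k <;> simp [gaussBinom]
  | succ n ih => cases k <;> simp [gaussBinom, ih]

theorem map_qBin (q : R) (n : ℕ) (a : ℤ) : f (qBin q n a) = qBin (f q) n a := by
  unfold qBin
  split_ifs
  · exact map_gaussBinom f q n _
  · exact map_zero f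

theorem map_expCoeff (K : ℕ) (C : ℕ → ℕ → R) (L r : ℕ) :
    f (expCoeff K C L r) = expCoeff K (fun M r => f (C M r)) L r := by
  unfold expCoeff
  split_ifs
  · rfl
  · exact map_zero f

theorem map_quadKernelA (q : R) (M r : ℕ) :
    f (quadKernelA q M r) = quadKernelA (f q) M r := by
  simp [quadKernelA, map_gaussBinom]

theorem map_quadKernelB (q : R) (M r : ℕ) :
    f (quadKernelB q M r) = quadKernelB (f q) M r := by
  simp [quadKernelB, map_gaussBinom]

theorem map_quadKernelC (q : R) (M r : ℕ) :
    f (quadKernelC q M r) = quadKernelC (f q) M r := by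
  cases M <;> simp [quadKernelC, map_gaussBinom]

theorem map_quarticKernel (q : R) (M r : ℕ) :
    f (quarticKernel q M r) = quarticKernel (f q) M r := by
  simp [quarticKernel, map_gaussBinom]

theorem map_cubicKernel (q : R) (M r : ℕ) :
    f (cubicKernel q M r) = cubicKernel (f q) M r := by
  cases M <;> simp [cubicKernel, map_gaussBinom, map_qBin]

theorem IsQBinBaseChange.of_injective {f : R →+* S} (hf : Function.Injective f) {q : R}
    {K k a : ℕ} {C : ℕ → ℕ → R}
    (h : IsQBinBaseChange (f q) K k a fun M r => f (C M r)) : IsQBinBaseChange q K k a C := by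
  intro L m
  apply hf
  have := h L m
  simpa only [map_mul, map_pow, map_sum, map_qBin, map_expCoeff] using this

end Transfer

/-! ### Real powers of q and the substitution q ↦ q^k. -/

section Exponents

theorem qPow_zero : qPow 0 = 1 := rfl

theorem qPow_add (x y : ℝ) : qPow (x + y) = qPow x * qPow y := by
  simp [qPow, AddMonoidAlgebra.single_mul_single]

theorem qPow_one_pow (n : ℕ) : qPow 1 ^ n = qPow n := by
  simp [qPow, AddMonoidAlgebra.single_pow]

theorem qPow_injective : Function.Injective qPow :=
  AddMonoidAlgebra.single_left_injective one_ne_zero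

theorem qPow_one_ne_zero : qPow 1 ≠ 0 := by
  simp [qPow]

theorem qPow_one_pow_ne_one (n : ℕ) (hn : 0 < n) : qPow 1 ^ n ≠ 1 := by
  rw [qPow_one_pow, ← qPow_zero]
  exact fun h => hn.ne' (by exact_mod_cast qPow_injective h)

/-- Base changes with kernel compatible with ring homomorphisms can be checked in a field. -/
theorem isQBinBaseChange_qExpr {K k a : ℕ} {C : ∀ {R : Type} [CommRing R], R → ℕ → ℕ → R}
    (hC : ∀ {R S : Type} [CommRing R] [CommRing S] (f : R →+* S) (q : R) (M r : ℕ),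
      f (C q M r) = C (f q) M r)
    (h : ∀ {F : Type} [Field F] {q : F}, q ≠ 0 → (∀ n : ℕ, 0 < n → q ^ n ≠ 1) →
      IsQBinBaseChange q K k a (C q)) :
    IsQBinBaseChange (qPow 1) K k a (C (qPow 1)) := by
  -- `QExpr` is a domain, so it embeds in a field, where q is still nonzero and not a root of unity.
  have hinj : Function.Injective (algebraMap QExpr (FractionRing QExpr)) :=
    IsFractionRing.injective QExpr (FractionRing QExpr)
  apply IsQBinBaseChange.of_injective hinj
  simp only [hC]
  apply h
  · rw [Ne, map_eq_zero_iff _ hinj]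
    exact qPow_one_ne_zero
  · intro n hn h1
    rw [← map_pow, map_eq_one_iff _ hinj] at h1
    exact qPow_one_pow_ne_one n hn h1

/-- The substitution `q ↦ q^k`. -/
noncomputable def qExpand (k : ℕ) : QExpr →+* QExpr :=
  AddMonoidAlgebra.mapDomainRingHom ℤ (AddMonoidHom.mulLeft (k : ℝ))

theorem qExpand_qPow (k : ℕ) (x : ℝ) : qExpand k (qPow x) = qPow (k * x) := by
  simp [qExpand, qPow]

end Exponents

/-! ### Closure properties of `NonnegPoly`. -/

section Nonneg

theorem nonnegPoly_zero : NonnegPoly 0 := ⟨0, by simp, by simp⟩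

theorem nonnegPoly_one : NonnegPoly 1 := by
  refine ⟨1, fun n => ?_, by simp⟩
  rw [Polynomial.coeff_one]
  split_ifs <;> norm_num

theorem nonnegPoly_qPow_one : NonnegPoly (qPow 1) := by
  refine ⟨Polynomial.X, fun n => ?_, by simp⟩
  rw [Polynomial.coeff_X]
  split_ifs <;> norm_num

theorem NonnegPoly.add {P Q : QExpr} (hP : NonnegPoly P) (hQ : NonnegPoly Q) :
    NonnegPoly (P + Q) := by
  obtain ⟨p, hp, rfl⟩ := hP
  obtain ⟨s, hs, rfl⟩ := hQ
  refine ⟨p + s, fun n => ?_, map_add _ _ _⟩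
  rw [Polynomial.coeff_add]
  exact add_nonneg (hp n) (hs n)

theorem NonnegPoly.mul {P Q : QExpr} (hP : NonnegPoly P) (hQ : NonnegPoly Q) :
    NonnegPoly (P * Q) := by
  obtain ⟨p, hp, rfl⟩ := hP
  obtain ⟨s, hs, rfl⟩ := hQ
  refine ⟨p * s, fun n => ?_, map_mul _ _ _⟩
  rw [Polynomial.coeff_mul]
  exact Finset.sum_nonneg fun x _ => mul_nonneg (hp _) (hs _)

theorem NonnegPoly.pow {P : QExpr} (hP : NonnegPoly P) (n : ℕ) : NonnegPoly (P ^ n) := by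
  induction n with
  | zero => simpa using nonnegPoly_one
  | succ n ih => simpa [pow_succ] using ih.mul hP

theorem nonnegPoly_sum {ι : Type*} {s : Finset ι} {P : ι → QExpr}
    (h : ∀ i ∈ s, NonnegPoly (P i)) : NonnegPoly (∑ i ∈ s, P i) :=
  Finset.sum_induction _ _ (fun _ _ => NonnegPoly.add) nonnegPoly_zero h

theorem nonnegPoly_prod {ι : Type*} {s : Finset ι} {P : ι → QExpr}
    (h : ∀ i ∈ s, NonnegPoly (P i)) : NonnegPoly (∏ i ∈ s, P i) :=
  Finset.prod_induction _ _ (fun _ _ => NonnegPoly.mul) nonnegPoly_one h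

theorem NonnegPoly.gaussBinom {P : QExpr} (hP : NonnegPoly P) (n k : ℕ) :
    NonnegPoly (gaussBinom P n k) := by
  induction n generalizing k with
  | zero =>
    cases k
    · exact nonnegPoly_one
    · exact nonnegPoly_zero
  | succ n ih =>
    cases k
    · exact nonnegPoly_one
    · exact (ih _).add ((hP.pow _).mul (ih _))

theorem NonnegPoly.qBin {P : QExpr} (hP : NonnegPoly P) (n : ℕ) (a : ℤ) :
    NonnegPoly (qBin P n a) := by
  unfold _root_.qBin
  split_ifs
  · exact hP.gaussBinom _ _
  · exact nonnegPoly_zero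

theorem NonnegPoly.qExpand {P : QExpr} (hP : NonnegPoly P) (k : ℕ) :
    NonnegPoly (qExpand k P) := by
  obtain ⟨p, hp, rfl⟩ := hP
  have h : _root_.qExpand k (Polynomial.aeval (qPow 1) p)
      = ∑ i ∈ Finset.range (p.natDegree + 1), _root_.qExpand k (p.coeff i • qPow 1 ^ i) := by
    rw [Polynomial.aeval_eq_sum_range, map_sum]
  rw [h]
  refine nonnegPoly_sum fun i _ => ?_
  -- A nonnegative coefficient n is read as a sum of n copies of the monomial, so closure under sums
  -- suffices.
  obtain ⟨n, hn⟩ := Int.eq_ofNat_of_zero_le (hp i)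
  rw [hn, map_zsmul, map_pow, qExpand_qPow, mul_one, ← qPow_one_pow, ← pow_mul, natCast_zsmul,
    ← Finset.card_range n, ← Finset.sum_const]
  exact nonnegPoly_sum fun _ _ => nonnegPoly_qPow_one.pow _

theorem NonnegPoly.quadKernelA {P : QExpr} (hP : NonnegPoly P) (M r : ℕ) :
    NonnegPoly (quadKernelA P M r) :=
  ((hP.pow _).mul (nonnegPoly_prod fun _ _ => nonnegPoly_one.add (hP.pow _))).mul
    (hP.gaussBinom _ _)

theorem NonnegPoly.quadKernelB {P : QExpr} (hP : NonnegPoly P) (M r : ℕ) :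
    NonnegPoly (quadKernelB P M r) :=
  ((hP.pow _).mul (nonnegPoly_prod fun _ _ => nonnegPoly_one.add (hP.pow _))).mul
    (hP.gaussBinom _ _)

theorem NonnegPoly.quadKernelC {P : QExpr} (hP : NonnegPoly P) (M r : ℕ) :
    NonnegPoly (quadKernelC P M r) := by
  cases M
  · exact hP.pow _
  · exact (((hP.pow _).mul (nonnegPoly_one.add (hP.pow _))).mul
      (nonnegPoly_prod fun _ _ => nonnegPoly_one.add (hP.pow _))).mul (hP.gaussBinom _ _)

theorem NonnegPoly.quarticKernel {P : QExpr} (hP : NonnegPoly P) (M r : ℕ) :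
    NonnegPoly (quarticKernel P M r) :=
  (nonnegPoly_prod fun _ _ => hP.add (hP.pow _)).mul ((hP.pow 2).gaussBinom _ _)

theorem NonnegPoly.cubicKernel {P : QExpr} (hP : NonnegPoly P) (M r : ℕ) :
    NonnegPoly (cubicKernel P M r) := by
  have hprod : ∀ n, NonnegPoly
      (∏ i ∈ Finset.range n, (1 + P ^ (i + 1) + P ^ (2 * (i + 1)))) := fun n =>
    nonnegPoly_prod fun _ _ => (nonnegPoly_one.add (hP.pow _)).add (hP.pow _)
  cases M
  · exact hP.pow _
  · exact (hP.pow _).mul (((((hP.pow 3).gaussBinom _ _).mul (hprod _)).mul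
      (nonnegPoly_one.add (hP.pow _))).add (((hP.pow _).mul ((hP.pow 3).qBin _ _)).mul (hprod _)))

end Nonneg

/-! ### From base changes to positivity of G. -/

section Main

theorem bressoudTerm_eq_zero (L : ℕ) (α β : ℝ) {K j : ℤ} (hK : 0 < K)
    (hj : j ∉ Finset.Icc (-(L : ℤ)) L) : bressoudTerm L α β K j = 0 := by
  have h : qBin (qPow 1) (2 * L) ((L : ℤ) - K * j) = 0 := by
    apply qBin_eq_zero
    rw [Finset.mem_Icc, not_and_or, not_le, not_le] at hj
    rcases hj with h | h
    · right
      push_cast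
      nlinarith
    · left
      nlinarith
  simp [bressoudTerm, h]

theorem bressoudG_eq_sum {L N : ℕ} (hLN : L ≤ N) (α β : ℝ) {K : ℤ} (hK : 0 < K) :
    bressoudG L α β K = ∑ j ∈ Finset.Icc (-(N : ℤ)) N, bressoudTerm L α β K j := by
  apply finsum_eq_sum_of_support_subset
  intro j hj
  by_contra hj'
  refine hj (bressoudTerm_eq_zero L α β hK fun hm => hj' ?_)
  rw [Finset.mem_Icc] at hm
  rw [Finset.coe_Icc, Set.mem_Icc]
  omega

/-- A base change of `q`-binomials with nonnegative kernel preserves positivity of `G`. -/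
theorem nonnegPoly_bressoudG_of_baseChange {c k a : ℕ} (hc : 0 < c) {C : ℕ → ℕ → QExpr}
    (hC : ∀ M r, NonnegPoly (C M r)) (hbc : IsQBinBaseChange (qPow 1) c k a C)
    {K : ℤ} (hK : 0 < K) {α β α' β' : ℝ} (hsum : c * (α' + β') = k * (α + β) + 2 * a * K)
    (hdiff : c * (α' - β') = k * (α - β))
    (h : ∀ L : ℕ, NonnegPoly (bressoudG L α β K)) (L : ℕ) :
    NonnegPoly (bressoudG L α' β' (c * K)) := by
  have hterm : ∀ j : ℤ, bressoudTerm L α' β' (c * K) j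
      = ∑ r ∈ Finset.range (L + 1), expCoeff c C L r * qExpand k (bressoudTerm r α β K j) := by
    intro j
    -- `hsum` matches the coefficients of j² and `hdiff` those of j; the surplus a (K j)² is the
    -- power of q in the base change at m = K j.
    have e : (((c * K : ℤ) : ℝ) * (j : ℝ) * ((α' + β') * (j : ℝ) + α' - β') / 2)
        = k * ((K : ℝ) * (j : ℝ) * ((α + β) * (j : ℝ) + α - β) / 2)
          + ((a * (K * j).natAbs ^ 2 : ℕ) : ℝ) := by
      have hsq : (((K * j).natAbs : ℕ) : ℝ) ^ 2 = ((K : ℝ) * j) ^ 2 := by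
        rw [Nat.cast_natAbs, Int.cast_abs, sq_abs, Int.cast_mul]
      push_cast
      rw [hsq]
      linear_combination (K * j * j / 2 : ℝ) * hsum + (K * j / 2 : ℝ) * hdiff
    have hb := hbc L (K * j)
    rw [bressoudTerm, e, qPow_add, ← qPow_one_pow, mul_assoc (qPow _), mul_assoc (c : ℤ), hb,
      Finset.mul_sum, Finset.smul_sum]
    refine Finset.sum_congr rfl fun r _ => ?_
    rw [bressoudTerm, map_zsmul, map_mul, qExpand_qPow, map_qBin, qExpand_qPow, mul_one,
      ← qPow_one_pow, mul_smul_comm, mul_left_comm]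
  -- The range |j| ≤ L serves every r ≤ L at once, so the two finite sums can be exchanged.
  rw [bressoudG_eq_sum le_rfl α' β' (by positivity), Finset.sum_congr rfl fun j _ => hterm j,
    Finset.sum_comm]
  refine nonnegPoly_sum fun r hr => ?_
  rw [← Finset.mul_sum, ← map_sum,
    ← bressoudG_eq_sum (Nat.lt_succ_iff.mp (Finset.mem_range.mp hr)) α β hK]
  refine NonnegPoly.mul ?_ ((h r).qExpand k)
  unfold expCoeff
  split_ifs
  · exact hC _ _
  · exact nonnegPoly_zero

end Main

theorem lemma9p2 (K : ℤ) (hK : 0 < K) (α β : ℝ)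
    (h : ∀ L : ℕ, NonnegPoly (bressoudG L α β K)) :
    (∀ L : ℕ, NonnegPoly (bressoudG L (α + K) (β + K) (2 * K))) ∧
    (∀ L : ℕ, NonnegPoly (bressoudG L α β (2 * K))) ∧
    (∀ L : ℕ, NonnegPoly (bressoudG L (α + (K : ℝ) / 2) (β + (K : ℝ) / 2) (2 * K))) ∧
    (∀ L : ℕ, NonnegPoly (bressoudG L (2 * α) (2 * β) (2 * K))) ∧
    (∀ L : ℕ, NonnegPoly (bressoudG L (α + K) (β + K) (3 * K))) := by
  have hq := nonnegPoly_qPow_one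
  refine ⟨?_, ?_, ?_, ?_, ?_⟩
  -- The triples (c, k, a) of the five base changes are (2, 2, 2), (2, 2, 0), (2, 2, 1), (2, 4, 0)
  -- and (3, 3, 3).
  · exact nonnegPoly_bressoudG_of_baseChange two_pos hq.quadKernelA
      (isQBinBaseChange_qExpr map_quadKernelA quadKernelA_isQBinBaseChange) hK
      (by push_cast; ring) (by push_cast; ring) h
  · exact nonnegPoly_bressoudG_of_baseChange two_pos hq.quadKernelB
      (isQBinBaseChange_qExpr map_quadKernelB quadKernelB_isQBinBaseChange) hK
      (by push_cast; ring) (by push_cast; ring) h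
  · exact nonnegPoly_bressoudG_of_baseChange two_pos hq.quadKernelC
      (isQBinBaseChange_qExpr map_quadKernelC quadKernelC_isQBinBaseChange) hK
      (by push_cast; ring) (by push_cast; ring) h
  · exact nonnegPoly_bressoudG_of_baseChange two_pos hq.quarticKernel
      (isQBinBaseChange_qExpr map_quarticKernel quarticKernel_isQBinBaseChange) hK
      (by push_cast; ring) (by push_cast; ring) h
  · exact nonnegPoly_bressoudG_of_baseChange three_pos hq.cubicKernel
      (isQBinBaseChange_qExpr map_cubicKernel cubicKernel_isQBinBaseChange) hK
      (by push_cast; ring) (by push_cast; ring) h
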